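/- Let $p$ be an odd prime, let $m,s\ge 1$ be integers, let $\mathbb F$ be the field with $p^m$ elements, and let $\mathcal R=\mathbb F[u,v]/\langle u^2,v^2,uv-vu\rangle=\mathbb F+u\mathbb F+v\mathbb F+uv\mathbb F$. Let $\alpha=\alpha_1+\alpha_3v+\alpha_4uv\in\mathcal R$ with $\alpha_1,\alpha_3\in\mathbb F\setminus\{0\}$ and $\alpha_4\in\mathbb F$, and assume that $\alpha$ is not a square in $\mathcal R$. Put $\mathcal R_\alpha=\mathcal R[x]/\langle x^{2p^s}-\alpha\rangle$ and $\alpha_0=\alpha_1^{p^{(q_0+1)m-s}}$ with $q_0=\lfloor s/m\rfloor$, so that $\alpha_0^{p^s}=\alpha_1$. An ideal of $\mathcal R_\alpha$ is regarded as a code of length $2p^s$ over $\mathcal R$ by identifying a word $(\zeta_0,\dots,\zeta_{2p^s-1})$ with the class of $\zeta_0+\zeta_1x+\dots+\zeta_{2p^s-1}x^{2p^s-1}$, and $d_H$ denotes the Hamming distance of this code, that is, the minimum number of coordinates in which two distinct codewords differ. Let $0\le \ell\le 2p^s-1$ and $0\le t<\ell$, let $z(x)\in\mathcal R_\alpha$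 be $0$ or a unit (for instance $z(x)=\sum_\kappa(z_{0\kappa}x+z_{1\kappa})(x^2-\alpha_0)^\kappa$ with $z_{0\kappa},z_{1\kappa}\in\mathbb F$ and $z_{00}x+z_{10}\ne 0$), and let $\mathcal C=\langle (x^2-\alpha_0)^\ell+u(x^2-\alpha_0)^tz(x)\rangle\subseteq\mathcal R_\alpha$. Then there is a smallest non-negative integer $\Im$ such that $u(x^2-\alpha_0)^{\Im}\in\mathcal C$; moreover $d_H(\mathcal C)=d_H(\langle u(x^2-\alpha_0)^{\Im}\rangle)$, and $$d_H(\mathcal C)=\begin{cases}1 & \text{if } 0\le\Im\le p^s,\\ (\Gamma+1)p^\gamma & \text{if } 2p^s-p^{s-\gamma}+(\Gamma-1)p^{s-\gamma-1}+1\le\Im\le 2p^s-p^{s-\gamma}+\Gamma p^{s-\gamma-1},\end{cases}$$ where in the second case $\Gamma,\gamma$ are any integers with $1\le\Gamma\le p-1$ and $0\le\gamma\le s-1$. -/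

import Mathlib

open Polynomial

/-- The ring `F[u, v] / ⟨u², v², uv - vu⟩ = F + uF + vF + uvF`. -/
abbrev UVRing (F : Type*) [CommRing F] : Type _ :=
  MvPolynomial (Fin 2) F ⧸
    Ideal.span ({MvPolynomial.X 0 ^ 2, MvPolynomial.X 1 ^ 2,
      MvPolynomial.X 0 * MvPolynomial.X 1 - MvPolynomial.X 1 * MvPolynomial.X 0} :
        Set (MvPolynomial (Fin 2) F))

namespace UVRing

variable (F : Type*) [CommRing F]

/-- The class of the indeterminate `u`. -/
noncomputable def u : UVRing F := Ideal.Quotient.mk _ (MvPolynomial.X 0)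

/-- The class of the indeterminate `v`. -/
noncomputable def v : UVRing F := Ideal.Quotient.mk _ (MvPolynomial.X 1)

end UVRing

/-- The ambient ring `A[x] / ⟨xⁿ - a⟩` of the `a`-constacyclic codes of length `n` over `A`. -/
abbrev ConstacyclicRing {A : Type*} [CommRing A] (n : ℕ) (a : A) : Type _ :=
  AdjoinRoot (X ^ n - C a)

/-- The polynomial representation `ζ₀ + ζ₁ x + ⋯ + ζₙ₋₁ xⁿ⁻¹` of a word of length `n`. -/
noncomputable def polyRep {A : Type*} [CommRing A] (n : ℕ) (a : A) (ζ : Fin n → A) :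
    ConstacyclicRing n a :=
  AdjoinRoot.mk (X ^ n - C a) (∑ i : Fin n, C (ζ i) * X ^ (i : ℕ))

/-- The code of length `n` over `A` given by an ideal of `A[x] / ⟨xⁿ - a⟩`: all words whose
polynomial representation lies in the ideal. -/
def codeOfIdeal {A : Type*} [CommRing A] {n : ℕ} {a : A} (I : Ideal (ConstacyclicRing n a)) :
    Set (Fin n → A) :=
  {ζ | polyRep n a ζ ∈ I}

open Classical in
/-- The Hamming distance of a code: the least Hamming distance of two distinct codewords
(and `0` for a code with at most one word). -/
noncomputable def codeDist {A : Type*} {n : ℕ} (K : Set (Fin n → A)) : ℕ :=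
  sInf {d : ℕ | ∃ x ∈ K, ∃ y ∈ K, x ≠ y ∧ hammingDist x y = d}

/-- The Hamming distance `d_H` of the code given by an ideal. -/
noncomputable def idealDist {A : Type*} [CommRing A] {n : ℕ} {a : A}
    (I : Ideal (ConstacyclicRing n a)) : ℕ :=
  codeDist (codeOfIdeal I)

section TypeC

variable {F : Type*} [Field F]

/-- The element `α₁ + α₃ v + α₄ uv`. -/
noncomputable def alphaElt (α₁ α₃ α₄ : F) : UVRing F :=
  algebraMap F (UVRing F) α₁ + algebraMap F (UVRing F) α₃ * UVRing.v F
    + algebraMap F (UVRing F) α₄ * (UVRing.u F * UVRing.v F)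

/-- `α₀ = α₁ ^ (p ^ ((q₀ + 1) m - s))`, where `q₀ = ⌊s / m⌋`; if `F` has `p ^ m` elements,
then `α₀ ^ (p ^ s) = α₁`. -/
def alphaZero (p m s : ℕ) (α₁ : F) : F :=
  α₁ ^ p ^ ((s / m + 1) * m - s)

/-- The class of `u` in `R[x] / ⟨xⁿ - a⟩`, where `R = F[u, v] / ⟨u², v², uv - vu⟩`. -/
noncomputable def uElt (n : ℕ) (a : UVRing F) : ConstacyclicRing n a :=
  AdjoinRoot.of (X ^ n - C a) (UVRing.u F)

/-- The class of `x² - b`, for `b ∈ F`, in `R[x] / ⟨xⁿ - a⟩`. -/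
noncomputable def quadElt (n : ℕ) (a : UVRing F) (b : F) : ConstacyclicRing n a :=
  AdjoinRoot.mk (X ^ n - C a) (X ^ 2 - C (algebraMap F (UVRing F) b))

/-- The ideal `⟨(x² - b)^ℓ + u (x² - b)^t z⟩` of `R[x] / ⟨xⁿ - a⟩`. -/
noncomputable def typeC (n : ℕ) (a : UVRing F) (b : F) (l t : ℕ) (z : ConstacyclicRing n a) :
    Ideal (ConstacyclicRing n a) :=
  Ideal.span {quadElt n a b ^ l + uElt n a * quadElt n a b ^ t * z}

/-- The ideal `⟨u (x² - b)^k⟩` of `R[x] / ⟨xⁿ - a⟩`. -/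
noncomputable def typeB (n : ℕ) (a : UVRing F) (b : F) (k : ℕ) : Ideal (ConstacyclicRing n a) :=
  Ideal.span {uElt n a * quadElt n a b ^ k}

/-- The smallest `k` with `u (x² - b)^k ∈ I`. -/
noncomputable def leastExp {n : ℕ} {a : UVRing F} (b : F) (I : Ideal (ConstacyclicRing n a)) : ℕ :=
  sInf {k : ℕ | uElt n a * quadElt n a b ^ k ∈ I}

end TypeC

/-! Write `W = x² - α₀`. Since `α₀ ^ (p ^ s) = α₁`, Frobenius gives `W ^ (p ^ s) = v (α₃ + α₄ u)`,
so `v` is a unit times `W ^ (p ^ s)` and `W` is nilpotent. As `α` is not a square, neither is `α₀`;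
hence `X² - α₀` is irreducible and every non-unit lies in `⟨u, W⟩`. Because `u² = 0`, the ideals of
multiples of `u` form the chain `⟨u W ^ j⟩`.

Multiplication by `u` does not increase weight and sends the code into `⟨u W ^ l⟩`, inside `⟨u W ^
e⟩`. A codeword killed by `u` is itself a multiple of `u`, so the chain property puts it in `⟨u W ^
e⟩`. Thus both codes have the same distance (`idealDist_eq_idealDist_typeB`).

If `e ≤ p ^ s`, the constant `α₃ uv = u W ^ (p ^ s)` has weight one. If `e = p ^ s + i`, the code is
`uv` times the code over `F` generated by `(X² - α₀) ^ i`. Its weights are bounded below through the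
even and odd parts of a polynomial and the repeated-root bound for `(X - α₀) ^ i`
(`le_card_support_of_X_sub_C_pow_dvd`); a power of `X² - α₀` attains the bound. -/

namespace Polynomial

/-! ### Splitting a polynomial by exponents modulo `q` -/

section Component

variable {R : Type*} [CommRing R]

/-- The `r`-th component of `f` modulo `q`: for `r < q` the polynomial whose `n`-th coefficient
is the coefficient of `X ^ (n * q + r)` in `f`. -/
noncomputable def component (q r : ℕ) (f : R[X]) : R[X] :=
  divX (contract q (X ^ (q - r) * f))

theorem coeff_component {q r : ℕ} (hr : r < q) (f : R[X]) (n : ℕ) :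
    (component q r f).coeff n = f.coeff (n * q + r) := by
  rw [component, coeff_divX, coeff_contract (by omega),
    show (n + 1) * q = n * q + r + (q - r) by rw [add_mul]; omega, coeff_X_pow_mul]

theorem X_mul_component {q r : ℕ} (hr : r < q) (f : R[X]) :
    X * component q r f = contract q (X ^ (q - r) * f) := by
  conv_rhs => rw [← X_mul_divX_add (contract q (X ^ (q - r) * f))]
  -- The shift `q - r` is positive, so the constant coefficient that `divX` drops is zero.
  rw [coeff_contract (by omega), zero_mul, mul_coeff_zero, coeff_X_pow,
    if_neg (by omega), zero_mul, C_0, add_zero, component]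

/-- A polynomial in `X ^ q` preserves residue classes of exponents, so components are linear over
such polynomials. Divisibility therefore passes to components. -/
theorem component_mul_expand {q r : ℕ} (hr : r < q) (f g : R[X]) :
    component q r (f * expand R q g) = component q r f * g := by
  rw [component, ← mul_assoc, contract_mul_expand (by omega), ← X_mul_component hr]
  ext n
  rw [mul_assoc, coeff_divX, coeff_X_mul]

theorem dvd_component {q r : ℕ} (hr : r < q) {f g : R[X]} (h : expand R q g ∣ f) :
    g ∣ component q r f := by
  obtain ⟨k, rfl⟩ := h
  rw [mul_comm, component_mul_expand hr]
  exact dvd_mul_left _ _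

theorem natDegree_component_lt {q r N : ℕ} (hr : r < q) {f : R[X]} (hN : 0 < N)
    (hf : f.natDegree < N * q) : (component q r f).natDegree < N := by
  suffices h : (component q r f).natDegree ≤ N - 1 by omega
  rw [natDegree_le_iff_coeff_eq_zero]
  intro n hn
  rw [coeff_component hr]
  refine coeff_eq_zero_of_natDegree_lt (hf.trans_le ?_)
  have := Nat.mul_le_mul_right q (show N ≤ n by omega)
  omega

theorem card_support_component {q r : ℕ} (hr : r < q) (f : R[X]) :
    (component q r f).support.card = (f.support.filter (· % q = r)).card := by
  refine Finset.card_bij (fun n _ => n * q + r) ?_ ?_ ?_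
  · intro n hn
    rw [mem_support_iff, coeff_component hr] at hn
    simp [hn, Nat.mod_eq_of_lt hr]
  · intro a _ b _ h
    exact Nat.eq_of_mul_eq_mul_right (by omega) (Nat.add_right_cancel h)
  · intro i hi
    rw [Finset.mem_filter, mem_support_iff] at hi
    have h : i / q * q + r = i := by rw [← hi.2, mul_comm]; exact Nat.div_add_mod i q
    exact ⟨i / q, by rw [mem_support_iff, coeff_component hr, h]; exact hi.1, h⟩

theorem card_support_eq_sum_component {q : ℕ} (hq : 0 < q) (f : R[X]) :
    f.support.card = ∑ r ∈ Finset.range q, (component q r f).support.card := by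
  rw [Finset.card_eq_sum_card_fiberwise (f := (· % q)) (t := Finset.range q)
    (fun i _ => by simpa using Nat.mod_lt i hq)]
  exact Finset.sum_congr rfl fun r hr =>
    (card_support_component (Finset.mem_range.1 hr) f).symm

theorem exists_component_ne_zero {q : ℕ} (hq : 0 < q) {f : R[X]} (hf : f ≠ 0) :
    ∃ r < q, component q r f ≠ 0 := by
  by_contra! h
  refine hf (ext fun i => ?_)
  have := congrArg (fun g => coeff g (i / q)) (h (i % q) (Nat.mod_lt _ hq))
  rwa [coeff_component (Nat.mod_lt _ hq), mul_comm, Nat.div_add_mod] at this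

theorem eq_X_pow_mul_expand_component {q r : ℕ} (hr : r < q) {f : R[X]}
    (h : ∀ j < q, j ≠ r → component q j f = 0) :
    f = X ^ r * expand R q (component q r f) := by
  ext i
  have hq : 0 < q := by omega
  rw [coeff_X_pow_mul']
  by_cases hi : i % q = r
  · have hle : r ≤ i := hi ▸ Nat.mod_le i q
    have hdiv : i - r = i / q * q := by
      have := Nat.div_add_mod' i q
      omega
    rw [if_pos hle, hdiv, coeff_expand_mul hq, coeff_component hr, ← hdiv, Nat.sub_add_cancel hle]
  · have h0 := congrArg (fun g => coeff g (i / q)) (h (i % q) (Nat.mod_lt _ hq) hi)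
    simp only [coeff_component (Nat.mod_lt _ hq), Nat.div_add_mod', coeff_zero] at h0
    rw [h0]
    split_ifs with hle
    · rw [coeff_expand hq, if_neg]
      intro hd
      refine hi ?_
      obtain ⟨c, hc⟩ := hd
      rw [show i = r + q * c by omega, Nat.add_mul_mod_self_left, Nat.mod_eq_of_lt hr]
    · rfl

theorem card_support_expand_le (q : ℕ) (f : R[X]) :
    (expand R q f).support.card ≤ f.support.card := by
  refine (Finset.card_le_card (t := f.support.image (· * q)) ?_).trans Finset.card_image_le
  intro i hi
  rcases Nat.eq_zero_or_pos q with rfl | hq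
  · have hf : f ≠ 0 := by rintro rfl; simp at hi
    obtain ⟨j, hj⟩ := support_nonempty.2 hf
    have : i = 0 := by
      by_contra h
      rw [expand_zero, mem_support_iff, coeff_C, if_neg h] at hi
      exact hi rfl
    exact Finset.mem_image.2 ⟨j, hj, by simp [this]⟩
  · rw [mem_support_iff, coeff_expand hq] at hi
    split_ifs at hi with h
    · exact Finset.mem_image.2 ⟨i / q, mem_support_iff.2 hi, Nat.div_mul_cancel h⟩
    · exact absurd rfl hi

theorem card_support_X_pow_sub_C_pow_le (q n : ℕ) (c : R) :
    ((X ^ q - C c) ^ n : R[X]).support.card ≤ n + 1 := by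
  have h : ((X ^ q - C c) ^ n : R[X]) = expand R q ((X - C c) ^ n) := by simp
  rw [h]
  refine (card_support_expand_le q _).trans ((card_supp_le_succ_natDegree _).trans ?_)
  have : ((X - C c) ^ n : R[X]).natDegree ≤ n * 1 :=
    natDegree_pow_le_of_le n (natDegree_X_sub_C_le c)
  omega

end Component

/-! ### Weights of multiples of powers of `X - a` and `X² - a` -/

section Weight

variable {F : Type*} [Field F]

/-- A nonzero polynomial of degree less than the characteristic with a nonzero root of
multiplicity `k` has more than `k` terms. -/
theorem lt_card_support_of_pow_dvd {p : ℕ} [CharP F p] {b : F} (hb : b ≠ 0) (k : ℕ) :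
    ∀ h : F[X], h ≠ 0 → h.natDegree < p → (X - C b) ^ k ∣ h → k < h.support.card := by
  induction k with
  | zero => exact fun h h0 _ _ => Finset.card_pos.2 (support_nonempty.2 h0)
  | succ k ih =>
    intro h h0 hdeg hdvd
    -- Removing the power of `X` keeps the number of terms and makes the constant term nonzero;
    -- differentiation then loses a term and only one order of the root `b`.
    obtain ⟨g, hg, hX⟩ := exists_eq_pow_rootMultiplicity_mul_and_not_dvd h h0 0
    rw [C_0, sub_zero] at hg hX
    set n := rootMultiplicity 0 h
    have hg0 : g ≠ 0 := by rintro rfl; simp at hX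
    have hcard : h.support.card = g.support.card := by
      rw [hg, mul_comm]
      refine (Finset.card_bij (fun i _ => i + n) ?_ ?_ ?_).symm
      · intro i hi
        rwa [mem_support_iff, coeff_mul_X_pow, ← mem_support_iff]
      · intro a _ b _ hab
        exact Nat.add_right_cancel hab
      · intro i hi
        rw [mem_support_iff, coeff_mul_X_pow'] at hi
        split_ifs at hi with hle
        · exact ⟨i - n, mem_support_iff.2 hi, Nat.sub_add_cancel hle⟩
        · exact absurd rfl hi
    have hcop : IsCoprime ((X - C b) ^ (k + 1)) (X ^ n : F[X]) := by
      refine IsCoprime.pow ?_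
      simpa using isCoprime_X_sub_C_of_isUnit_sub (a := b) (b := (0 : F)) (by simpa using hb)
    have hgd : (X - C b) ^ (k + 1) ∣ g := hcop.dvd_of_dvd_mul_left (hg ▸ hdvd)
    have hgdeg : g.natDegree < p := by
      refine lt_of_le_of_lt ?_ hdeg
      conv_rhs => rw [hg]
      rw [natDegree_mul (pow_ne_zero _ X_ne_zero) hg0]
      omega
    have hcoeff0 : g.coeff 0 ≠ 0 := by rwa [X_dvd_iff] at hX
    have hg1 : 0 < g.natDegree := by
      by_contra hcon
      have hle := natDegree_le_of_dvd hgd hg0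
      rw [natDegree_pow, natDegree_X_sub_C] at hle
      omega
    -- The degree is positive and below `p`, so the leading term survives differentiation.
    have hd0 : derivative g ≠ 0 := by
      intro hd
      have := congrArg (fun q => coeff q (g.natDegree - 1)) hd
      simp only [coeff_derivative, coeff_zero] at this
      rw [Nat.sub_add_cancel hg1] at this
      rcases mul_eq_zero.1 this with h1 | h1
      · exact hg0 (leadingCoeff_eq_zero.1 h1)
      · have h2 : ((g.natDegree : ℕ) : F) = 0 := by
          rw [← h1]
          conv_lhs => rw [← Nat.sub_add_cancel hg1]
          push_cast
          ring
        rw [CharP.cast_eq_zero_iff F p] at h2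
        exact absurd (Nat.le_of_dvd hg1 h2) (by omega)
    have hdd : (X - C b) ^ k ∣ derivative g := by
      obtain ⟨c, hc⟩ := hgd
      rw [hc, derivative_mul, derivative_pow]
      exact dvd_add (((dvd_mul_left _ _).mul_right _).mul_right _)
        ((pow_dvd_pow _ (Nat.le_succ k)).mul_right _)
    have hlt := ih _ hd0 ((natDegree_derivative_lt hg1.ne').trans hgdeg) hdd
    rw [hcard]
    refine Nat.lt_of_le_of_lt (Nat.succ_le_of_lt hlt) ?_
    have hsub : (derivative g).support.card ≤ (g.support.erase 0).card := by
      refine Finset.card_le_card_of_injOn (· + 1) ?_ ?_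
      · intro i hi
        simp only [Finset.mem_coe, mem_support_iff, coeff_derivative] at hi
        simp only [Finset.mem_coe, Finset.mem_erase, mem_support_iff]
        exact ⟨by omega, left_ne_zero_of_mul hi⟩
      · intro a _ b _ hab
        exact Nat.add_right_cancel hab
    exact hsub.trans_lt (Finset.card_erase_lt_of_mem (mem_support_iff.2 hcoeff0))

variable {p : ℕ} [Fact p.Prime] [CharP F p] {a : F}

theorem X_sub_C_pow_mul_char_pow (a : F) (n k : ℕ) :
    (X - C a) ^ (n * p ^ k) = expand F (p ^ k) ((X - C (a ^ p ^ k)) ^ n) := by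
  rw [mul_comm, pow_mul, sub_pow_char_pow, map_pow, map_sub, expand_X, expand_C, C_pow]

/-- Each nonzero component modulo `p ^ k` has at least `G + 1` terms, so two of them suffice. With a
single one, the extra factor `X - a` forces a further root `a ^ p ^ k` of that component. -/
theorem le_card_support_of_pow_dvd_base (ha : a ≠ 0) {k G : ℕ} {f : F[X]}
    (hf : f ≠ 0) (hdeg : f.natDegree < p * p ^ k) (hdvd : (X - C a) ^ (G * p ^ k + 1) ∣ f) :
    G + 2 ≤ f.support.card := by
  have hp := (Fact.out : p.Prime).pos
  have hq : 0 < p ^ k := pow_pos hp k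
  have hb : a ^ p ^ k ≠ 0 := pow_ne_zero _ ha
  have hcomp : ∀ r < p ^ k, component (p ^ k) r f ≠ 0 →
      G < (component (p ^ k) r f).support.card := fun r hr h0 =>
    lt_card_support_of_pow_dvd hb G _ h0 (natDegree_component_lt hr hp hdeg)
      (dvd_component hr (X_sub_C_pow_mul_char_pow (p := p) a G k ▸
        (pow_dvd_pow _ (Nat.le_succ _)).trans hdvd))
  obtain ⟨r, hr, h0⟩ := exists_component_ne_zero hq hf
  have hsum := card_support_eq_sum_component hq f
  by_cases hone : ∀ j < p ^ k, j ≠ r → component (p ^ k) j f = 0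
  · set h := component (p ^ k) r f with hh
    have hfe := eq_X_pow_mul_expand_component hr hone
    rw [← hh] at hfe
    obtain ⟨g, hg⟩ : (X - C (a ^ p ^ k)) ^ G ∣ h :=
      dvd_component hr (X_sub_C_pow_mul_char_pow (p := p) a G k ▸
        (pow_dvd_pow _ (Nat.le_succ _)).trans hdvd)
    have hcop : IsCoprime ((X - C a) ^ (G * p ^ k + 1)) (X ^ r : F[X]) := by
      refine IsCoprime.pow ?_
      simpa using isCoprime_X_sub_C_of_isUnit_sub (a := a) (b := (0 : F)) (by simpa using ha)
    have h1 : (X - C a) ^ (G * p ^ k + 1) ∣ expand F (p ^ k) h :=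
      hcop.dvd_of_dvd_mul_left (hfe ▸ hdvd)
    rw [hg, map_mul, ← X_sub_C_pow_mul_char_pow, pow_succ] at h1
    have h2 := (mul_dvd_mul_iff_left (pow_ne_zero _ (X_sub_C_ne_zero a))).1 h1
    rw [dvd_iff_isRoot, IsRoot, expand_eval, ← IsRoot, ← dvd_iff_isRoot] at h2
    have h3 : (X - C (a ^ p ^ k)) ^ (G + 1) ∣ h := by
      rw [hg, pow_succ]; exact mul_dvd_mul_left _ h2
    have h4 := lt_card_support_of_pow_dvd hb (G + 1) _ h0 (natDegree_component_lt hr hp hdeg) h3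
    rw [hsum]
    exact (Nat.succ_le_of_lt h4).trans
      (Finset.single_le_sum (f := fun r => (component (p ^ k) r f).support.card)
        (fun _ _ => Nat.zero_le _) (Finset.mem_range.2 hr))
  · push Not at hone
    obtain ⟨j, hj, hjr, hj0⟩ := hone
    have h1 := hcomp r hr h0
    have h2 := hcomp j hj hj0
    have h3 := Finset.sum_le_sum_of_subset (f := fun r => (component (p ^ k) r f).support.card)
      (show {j, r} ⊆ Finset.range (p ^ k) by
        intro i hi
        rcases Finset.mem_insert.1 hi with rfl | hi
        · exact Finset.mem_range.2 hj
        · exact Finset.mem_range.2 (Finset.mem_singleton.1 hi ▸ hr))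
    rw [Finset.sum_pair hjr, ← hsum] at h3
    omega

/-- Distinct terms of `g` lie in distinct classes modulo `p ^ k`, and each becomes a constant times
`(X - a ^ p ^ k) ^ (p - 1)`, which has `p` terms. -/
theorem mul_card_support_le_of_mul_expand (ha : a ≠ 0) {k : ℕ} {g : F[X]}
    (hg : g.natDegree < p ^ k) :
    p * g.support.card ≤ (g * (X - C a) ^ ((p - 1) * p ^ k)).support.card := by
  have hp := (Fact.out : p.Prime).pos
  have hq : 0 < p ^ k := pow_pos hp k
  have hsub : g.support ⊆ Finset.range (p ^ k) := fun r hr =>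
    Finset.mem_range.2 ((le_natDegree_of_mem_supp r hr).trans_lt hg)
  rw [card_support_eq_sum_component hq (g * _), mul_comm, ← smul_eq_mul]
  refine (Finset.card_nsmul_le_sum _ (fun r => (component (p ^ k) r
    (g * (X - C a) ^ ((p - 1) * p ^ k))).support.card) _ fun r hr => ?_).trans
    (Finset.sum_le_sum_of_subset hsub)
  have hrq := Finset.mem_range.1 (hsub hr)
  have hc : component (p ^ k) r g ≠ 0 := by
    intro h
    have := congrArg (fun q => coeff q 0) h
    simp only [coeff_component hrq, zero_mul, zero_add, coeff_zero] at this
    exact mem_support_iff.1 hr this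
  have hcd : (component (p ^ k) r g).natDegree < 1 :=
    natDegree_component_lt hrq one_pos (by rwa [one_mul])
  have hpow : ((X - C (a ^ p ^ k)) ^ (p - 1) : F[X]) ≠ 0 := pow_ne_zero _ (X_sub_C_ne_zero _)
  rw [X_sub_C_pow_mul_char_pow, component_mul_expand hrq]
  have := lt_card_support_of_pow_dvd (p := p) (pow_ne_zero (p ^ k) ha) (p - 1) _
    (mul_ne_zero hc hpow) (by
      rw [natDegree_mul hc hpow, natDegree_pow, natDegree_X_sub_C]; omega) (dvd_mul_left _ _)
  omega

/-- The lower bound for the weights in the repeated-root constacyclic code of length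
`p ^ (γ + k + 1)` generated by a power of `X - a`. -/
theorem le_card_support_of_X_sub_C_pow_dvd (ha : a ≠ 0) {k G : ℕ} (γ : ℕ) :
    ∀ f : F[X], f ≠ 0 → f.natDegree < p ^ (γ + k + 1) →
      (X - C a) ^ ((p ^ γ - 1) * p ^ (k + 1) + G * p ^ k + 1) ∣ f →
      (G + 2) * p ^ γ ≤ f.support.card := by
  have hp := (Fact.out : p.Prime).pos
  induction γ with
  | zero =>
    intro f hf hdeg hdvd
    rw [zero_add, pow_succ'] at hdeg
    simp only [pow_zero, Nat.sub_self, zero_mul, zero_add] at hdvd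
    simpa using le_card_support_of_pow_dvd_base ha hf hdeg hdvd
  | succ γ ih =>
    intro f hf hdeg hdvd
    -- Splitting off the leading base-`p` digit `p - 1` of the exponent gains a factor `p` in weight
    -- and leaves the case `γ`.
    have hexp : (p ^ (γ + 1) - 1) * p ^ (k + 1) + G * p ^ k + 1 =
        (p - 1) * p ^ (γ + k + 1) + ((p ^ γ - 1) * p ^ (k + 1) + G * p ^ k + 1) := by
      have h1 : 1 ≤ p ^ γ := pow_pos hp γ
      have h2 : p ^ (γ + 1) - 1 = (p - 1) * p ^ γ + (p ^ γ - 1) := by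
        rw [pow_succ', Nat.sub_mul, one_mul]
        have := Nat.mul_le_mul_right (p ^ γ) hp
        omega
      rw [h2, add_mul, mul_assoc, ← pow_add]
      ring_nf
    rw [hexp, pow_add] at hdvd
    obtain ⟨c, hc⟩ := hdvd
    rw [mul_assoc, mul_comm] at hc
    set g := (X - C a) ^ ((p ^ γ - 1) * p ^ (k + 1) + G * p ^ k + 1) * c with hg
    have hpow : ((X - C a) ^ ((p - 1) * p ^ (γ + k + 1)) : F[X]) ≠ 0 :=
      pow_ne_zero _ (X_sub_C_ne_zero _)
    have hg0 : g ≠ 0 := by rintro h; rw [h, zero_mul] at hc; exact hf hc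
    have hgd : g.natDegree < p ^ (γ + k + 1) := by
      rw [hc, natDegree_mul hg0 hpow, natDegree_pow, natDegree_X_sub_C, mul_one,
        show γ + 1 + k + 1 = (γ + k + 1) + 1 by ring, pow_succ' p (γ + k + 1)] at hdeg
      have : p * p ^ (γ + k + 1) = (p - 1) * p ^ (γ + k + 1) + p ^ (γ + k + 1) := by
        rw [← Nat.succ_mul, Nat.succ_eq_add_one, Nat.sub_add_cancel hp]
      omega
    rw [hc]
    refine le_trans ?_ (mul_card_support_le_of_mul_expand ha hgd)
    have := Nat.mul_le_mul_left p (ih g hg0 hgd (dvd_mul_right _ _))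
    calc (G + 2) * p ^ (γ + 1) = p * ((G + 2) * p ^ γ) := by ring
      _ ≤ _ := this

theorem le_card_support_of_X_sq_sub_C_pow_dvd (ha : a ≠ 0) {k G γ : ℕ}
    {f : F[X]} (hf : f ≠ 0) (hdeg : f.natDegree < 2 * p ^ (γ + k + 1))
    (hdvd : (X ^ 2 - C a) ^ ((p ^ γ - 1) * p ^ (k + 1) + G * p ^ k + 1) ∣ f) :
    (G + 2) * p ^ γ ≤ f.support.card := by
  have hp := (Fact.out : p.Prime).pos
  obtain ⟨r, hr, h0⟩ := exists_component_ne_zero two_pos hf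
  have hexp : ((X ^ 2 - C a) ^ ((p ^ γ - 1) * p ^ (k + 1) + G * p ^ k + 1) : F[X]) =
      expand F 2 ((X - C a) ^ ((p ^ γ - 1) * p ^ (k + 1) + G * p ^ k + 1)) := by simp
  refine (le_card_support_of_X_sub_C_pow_dvd ha γ _ h0
    (natDegree_component_lt hr (pow_pos hp _) (by rwa [mul_comm]))
    (dvd_component hr (hexp ▸ hdvd))).trans ?_
  rw [card_support_eq_sum_component two_pos f]
  exact Finset.single_le_sum (f := fun r => (component 2 r f).support.card)
    (fun _ _ => Nat.zero_le _) (Finset.mem_range.2 hr)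

/-- By Frobenius the two summands of the exponent give powers of binomials with at most `p ^ γ` and
`G + 1` terms. -/
theorem card_support_X_sq_sub_C_pow_le (a : F) (k G γ : ℕ) :
    ((X ^ 2 - C a) ^ ((p ^ γ - 1) * p ^ (k + 1) + G * p ^ k) : F[X]).support.card ≤
      (G + 1) * p ^ γ := by
  have hp := (Fact.out : p.Prime).pos
  have h : ∀ n k : ℕ, ((X ^ 2 - C a) ^ (n * p ^ k) : F[X]).support.card ≤ n + 1 := by
    intro n k
    rw [mul_comm, pow_mul, sub_pow_char_pow, ← pow_mul, ← C_pow]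
    exact card_support_X_pow_sub_C_pow_le _ _ _
  rw [pow_add, mul_comm (G + 1)]
  refine card_support_mul_le.trans (Nat.mul_le_mul ((h _ _).trans ?_) (h _ _))
  have : 1 ≤ p ^ γ := pow_pos hp γ
  omega

end Weight

end Polynomial

/-! ### Coordinates in the coefficient ring, and its squares -/

namespace UVRing

section Coordinates

variable (F : Type*) [Field F]

theorem u_mul_self : u F * u F = 0 := by
  rw [u, ← map_mul, Ideal.Quotient.eq_zero_iff_mem, ← pow_two]
  exact Ideal.subset_span (by simp)

theorem v_mul_self : v F * v F = 0 := by
  rw [v, ← map_mul, Ideal.Quotient.eq_zero_iff_mem, ← pow_two]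
  exact Ideal.subset_span (by simp)

/-- The homomorphism from `F[u, v] / ⟨u², v², uv - vu⟩` to the iterated dual numbers. -/
noncomputable def toDualNumber : UVRing F →+* DualNumber (DualNumber F) :=
  Ideal.Quotient.lift _
    (MvPolynomial.eval₂Hom
      ((TrivSqZeroExt.inlHom (DualNumber F) (DualNumber F)).comp (TrivSqZeroExt.inlHom F F))
      ![(DualNumber.eps : DualNumber (DualNumber F)), TrivSqZeroExt.inl DualNumber.eps]) (by
      intro a ha
      rw [← RingHom.mem_ker]
      refine (Ideal.span_le.2 ?_) ha
      rintro x (rfl | rfl | rfl)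
      · simp [pow_two]
      · simp [pow_two, ← TrivSqZeroExt.inl_mul]
      · simp [mul_comm])

theorem toDualNumber_u : toDualNumber F (u F) = DualNumber.eps := by
  rw [toDualNumber, u, Ideal.Quotient.lift_mk]
  simp

theorem toDualNumber_v : toDualNumber F (v F) = TrivSqZeroExt.inl DualNumber.eps := by
  rw [toDualNumber, v, Ideal.Quotient.lift_mk]
  simp

theorem toDualNumber_algebraMap (c : F) :
    toDualNumber F (algebraMap F _ c) = TrivSqZeroExt.inl (TrivSqZeroExt.inl c) := by
  change toDualNumber F (Ideal.Quotient.mk _ (MvPolynomial.C c)) = _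
  rw [toDualNumber, Ideal.Quotient.lift_mk]
  simp

variable {F}

theorem exists_coordinates (r : UVRing F) : ∃ a b c d : F,
    r = algebraMap F _ a + algebraMap F _ b * u F + algebraMap F _ c * v F +
      algebraMap F _ d * (u F * v F) := by
  obtain ⟨f, rfl⟩ := Ideal.Quotient.mk_surjective r
  have hu := u_mul_self F
  have hv := v_mul_self F
  induction f using MvPolynomial.induction_on with
  | C a => exact ⟨a, 0, 0, 0, by simp; rfl⟩
  | add f g hf hg =>
    obtain ⟨a, b, c, d, h⟩ := hf
    obtain ⟨a', b', c', d', h'⟩ := hg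
    refine ⟨a + a', b + b', c + c', d + d', ?_⟩
    rw [map_add, h, h']
    simp only [map_add]
    ring
  | mul_X f i hf =>
    obtain ⟨a, b, c, d, h⟩ := hf
    rw [map_mul, h]
    fin_cases i
    · refine ⟨0, a, 0, c, ?_⟩
      change _ * u F = _
      simp only [map_zero]
      linear_combination (algebraMap F (UVRing F) b + algebraMap F (UVRing F) d * v F) * hu
    · refine ⟨0, 0, a, b, ?_⟩
      change _ * v F = _
      simp only [map_zero]
      linear_combination (algebraMap F (UVRing F) c + algebraMap F (UVRing F) d * u F) * hv

/-- The four coordinates can be read off in the iterated dual numbers. -/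
theorem coordinates_eq_zero {a b c d : F}
    (h : algebraMap F (UVRing F) a + algebraMap F _ b * u F + algebraMap F _ c * v F +
      algebraMap F _ d * (u F * v F) = 0) : a = 0 ∧ b = 0 ∧ c = 0 ∧ d = 0 := by
  have h' := congrArg (toDualNumber F) h
  simp only [map_add, map_mul, toDualNumber_algebraMap, toDualNumber_u, toDualNumber_v, map_zero] at h'
  have h1 := congrArg (fun x => x.fst.fst) h'
  have h2 := congrArg (fun x => x.snd.fst) h'
  have h3 := congrArg (fun x => x.fst.snd) h'
  have h4 := congrArg (fun x => x.snd.snd) h'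
  simp at h1 h2 h3 h4
  exact ⟨h1, h2, h3, h4⟩

theorem exists_eq_u_mul_of_u_mul_eq_zero {r : UVRing F} (h : u F * r = 0) :
    ∃ r', r = u F * r' := by
  obtain ⟨a, b, c, d, rfl⟩ := exists_coordinates r
  have hu := u_mul_self F
  have := coordinates_eq_zero (F := F) (a := 0) (b := a) (c := 0) (d := c) (by
    simp only [map_zero]
    linear_combination h - (algebraMap F (UVRing F) b + algebraMap F (UVRing F) d * v F) * hu)
  obtain ⟨-, rfl, -, rfl⟩ := this
  exact ⟨algebraMap F _ b + algebraMap F _ d * v F, by simp only [map_zero]; ring⟩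

theorem algebraMap_mul_u_mul_v_eq_zero {c : F} :
    algebraMap F (UVRing F) c * (u F * v F) = 0 ↔ c = 0 := by
  refine ⟨fun h => ?_, by rintro rfl; simp⟩
  exact (coordinates_eq_zero (F := F) (a := 0) (b := 0) (c := 0) (d := c) (by simpa using h)).2.2.2

theorem exists_eq_algebraMap_add (r : UVRing F) :
    ∃ (a : F) (y z : UVRing F), r = algebraMap F _ a + u F * y + v F * z := by
  obtain ⟨a, b, c, d, rfl⟩ := exists_coordinates r
  exact ⟨a, algebraMap F _ b, algebraMap F _ c + algebraMap F _ d * u F, by ring⟩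

instance : Nontrivial (UVRing F) :=
  ⟨u F * v F, 0, fun h => one_ne_zero
    ((algebraMap_mul_u_mul_v_eq_zero (F := F) (c := 1)).1 (by simpa using h))⟩

end Coordinates

end UVRing

/-- If `α₁ = β²`, the root `β + (2β)⁻¹ (α₃ + α₄ u) v` is exact because `v² = 0`. -/
theorem isSquare_alphaElt {F : Type*} [Field F] (h2 : (2 : F) ≠ 0) {α₁ : F} (h0 : α₁ ≠ 0)
    (h : IsSquare α₁) (α₃ α₄ : F) : IsSquare (alphaElt α₁ α₃ α₄) := by
  obtain ⟨β, rfl⟩ := h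
  have hβ : β ≠ 0 := left_ne_zero_of_mul h0
  set i := algebraMap F (UVRing F)
  refine ⟨i β + i (2 * β)⁻¹ * (i α₃ + i α₄ * UVRing.u F) * UVRing.v F, ?_⟩
  have h1 : 2 * (i β * i (2 * β)⁻¹) = 1 := by
    rw [← map_ofNat i 2, ← map_mul, ← map_mul, ← mul_assoc,
      mul_inv_cancel₀ (mul_ne_zero h2 hβ), map_one]
  rw [alphaElt, map_mul]
  linear_combination (-(i α₃ + i α₄ * UVRing.u F) * UVRing.v F) * h1 -
    (i (2 * β)⁻¹ * (i α₃ + i α₄ * UVRing.u F)) ^ 2 * UVRing.v_mul_self F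

/-! ### Words, ideals and minimum weight -/

section Constacyclic

variable {A : Type*} [CommRing A] {n : ℕ} {a : A}

theorem polyRep_sub (x y : Fin n → A) :
    polyRep n a (x - y) = polyRep n a x - polyRep n a y := by
  simp [polyRep, sub_mul]

theorem polyRep_mul (c : A) (x : Fin n → A) :
    polyRep n a (fun i => c * x i) = AdjoinRoot.of _ c * polyRep n a x := by
  rw [polyRep, polyRep, ← AdjoinRoot.mk_C, ← map_mul, Finset.mul_sum]
  simp [mul_assoc]

theorem polyRep_coeff {P : A[X]} (hP : P.natDegree < n) :
    polyRep n a (fun i => P.coeff i) = AdjoinRoot.mk _ P := by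
  rw [polyRep, Fin.sum_univ_eq_sum_range (fun i => C (P.coeff i) * X ^ i),
    ← as_sum_range_C_mul_X_pow' P hP]

theorem polyRep_eq_zero [Nontrivial A] (hn : 0 < n) {x : Fin n → A} :
    polyRep n a x = 0 ↔ x = 0 := by
  refine ⟨fun h => ?_, by rintro rfl; simp [polyRep]⟩
  by_contra hx
  rw [polyRep, AdjoinRoot.mk_eq_zero] at h
  set P := ∑ i : Fin n, C (x i) * X ^ (i : ℕ) with hP
  have hcoeff : ∀ i : Fin n, P.coeff i = x i := by
    intro i
    simp only [hP, finsetSum_coeff, coeff_C_mul, coeff_X_pow, Fin.val_inj]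
    simp
  have hP0 : P ≠ 0 := by
    intro h0
    exact hx (funext fun i => by rw [← hcoeff, h0]; simp)
  have hdeg : P.degree < n := degree_sum_fin_lt _
  refine (monic_X_pow_sub_C a hn.ne').not_dvd_of_degree_lt hP0 ?_ h
  rwa [degree_X_pow_sub_C hn]

open Classical in
theorem idealDist_eq_sInf (I : Ideal (ConstacyclicRing n a)) :
    idealDist I = sInf {d | ∃ x : Fin n → A, x ≠ 0 ∧ polyRep n a x ∈ I ∧ hammingNorm x = d} := by
  rw [idealDist, codeDist]
  congr 1
  ext d
  constructor
  · rintro ⟨x, hx, y, hy, hxy, rfl⟩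
    refine ⟨-y + x, ?_, ?_, ?_⟩
    · simpa [neg_add_eq_zero] using hxy.symm
    · rw [neg_add_eq_sub, polyRep_sub]
      exact I.sub_mem hx hy
    · rw [hammingDist_comm, hammingDist_eq_hammingNorm]
  · rintro ⟨x, hx, hxI, rfl⟩
    refine ⟨x, hxI, 0, ?_, hx, ?_⟩
    · simp [codeOfIdeal, polyRep]
    · rw [hammingDist_zero_right]

open Classical in
theorem idealDist_eq_of_forall {I : Ideal (ConstacyclicRing n a)} {d : ℕ}
    (hex : ∃ x : Fin n → A, x ≠ 0 ∧ polyRep n a x ∈ I ∧ hammingNorm x ≤ d)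
    (hall : ∀ x : Fin n → A, x ≠ 0 → polyRep n a x ∈ I → d ≤ hammingNorm x) :
    idealDist I = d := by
  rw [idealDist_eq_sInf]
  obtain ⟨x, hx, hxI, hxd⟩ := hex
  refine le_antisymm (le_trans (csInf_le (OrderBot.bddBelow _) ⟨x, hx, hxI, rfl⟩) hxd)
    (le_csInf ⟨_, x, hx, hxI, rfl⟩ ?_)
  rintro _ ⟨y, hy, hyI, rfl⟩
  exact hall y hy hyI

open Classical in
theorem idealDist_eq_of_le {I J : Ideal (ConstacyclicRing n a)} (hle : I ≤ J)
    (h : ∀ x : Fin n → A, x ≠ 0 → polyRep n a x ∈ J →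
      ∃ y : Fin n → A, y ≠ 0 ∧ polyRep n a y ∈ I ∧ hammingNorm y ≤ hammingNorm x) :
    idealDist J = idealDist I := by
  by_cases hJ : ∃ x : Fin n → A, x ≠ 0 ∧ polyRep n a x ∈ J
  · obtain ⟨x, hx, hxJ⟩ := hJ
    obtain ⟨y, hy, hyI, -⟩ := h x hx hxJ
    obtain ⟨w, hw, hwI, hwd⟩ := Nat.sInf_mem
      (s := {d | ∃ x : Fin n → A, x ≠ 0 ∧ polyRep n a x ∈ I ∧ hammingNorm x = d})
      ⟨_, y, hy, hyI, rfl⟩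
    rw [idealDist_eq_sInf I]
    refine idealDist_eq_of_forall ⟨w, hw, hle hwI, hwd.le⟩ fun x hx hxJ => ?_
    obtain ⟨y, hy, hyI, hyx⟩ := h x hx hxJ
    exact le_trans (csInf_le (OrderBot.bddBelow _) ⟨y, hy, hyI, rfl⟩) hyx
  · push Not at hJ
    rw [idealDist_eq_sInf, idealDist_eq_sInf]
    congr 1
    ext d
    constructor
    · rintro ⟨x, hx, hxJ, -⟩
      exact absurd hxJ (hJ x hx)
    · rintro ⟨x, hx, hxI, -⟩
      exact absurd (hle hxI) (hJ x hx)

end Constacyclic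

/-! ### Polynomials over `F` and words with entries in `uv F` -/

section Ambient

variable {F : Type*} [Field F]

/-- The image of a polynomial over `F` in `R[x] / ⟨xⁿ - a⟩`. -/
noncomputable def ofPoly (n : ℕ) (a : UVRing F) : F[X] →+* ConstacyclicRing n a :=
  (AdjoinRoot.mk (X ^ n - C a)).comp (mapRingHom (algebraMap F (UVRing F)))

/-- The class of `v` in `R[x] / ⟨xⁿ - a⟩`. -/
noncomputable def vElt (n : ℕ) (a : UVRing F) : ConstacyclicRing n a :=
  AdjoinRoot.of (X ^ n - C a) (UVRing.v F)

variable {n : ℕ} {a : UVRing F}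

theorem quadElt_eq_ofPoly (b : F) : quadElt n a b = ofPoly n a (X ^ 2 - C b) := by
  simp [quadElt, ofPoly]

theorem ofPoly_C (c : F) :
    ofPoly n a (C c) = AdjoinRoot.of _ (algebraMap F (UVRing F) c) := by
  simp [ofPoly]

theorem ofPoly_C_mul_inv {c : F} (hc : c ≠ 0) :
    ofPoly n a (C c) * ofPoly n a (C c⁻¹) = 1 := by
  rw [← map_mul, ← C_mul, mul_inv_cancel₀ hc, C_1, map_one]

theorem uElt_mul_self : uElt n a * uElt n a = 0 := by
  rw [uElt, ← map_mul, UVRing.u_mul_self, map_zero]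

theorem vElt_mul_self : vElt n a * vElt n a = 0 := by
  rw [vElt, ← map_mul, UVRing.v_mul_self, map_zero]

theorem exists_eq_ofPoly_add (x : ConstacyclicRing n a) :
    ∃ (Q : F[X]) (y z : ConstacyclicRing n a), x = ofPoly n a Q + uElt n a * y + vElt n a * z := by
  obtain ⟨P, rfl⟩ := AdjoinRoot.mk_surjective x
  induction P using Polynomial.induction_on' with
  | add P Q hP hQ =>
    obtain ⟨P', y, z, h⟩ := hP
    obtain ⟨Q', y', z', h'⟩ := hQ
    refine ⟨P' + Q', y + y', z + z', ?_⟩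
    rw [map_add, h, h', map_add]
    ring
  | monomial k r =>
    obtain ⟨c, y, z, rfl⟩ := UVRing.exists_eq_algebraMap_add r
    have h : ∀ r : UVRing F, AdjoinRoot.mk (X ^ n - C a) (monomial k r) =
        AdjoinRoot.of _ r * AdjoinRoot.root _ ^ k := by
      intro r
      rw [← C_mul_X_pow_eq_monomial, map_mul, map_pow, AdjoinRoot.mk_C, AdjoinRoot.mk_X]
    have h' : ofPoly n a (monomial k c) =
        AdjoinRoot.of _ (algebraMap F (UVRing F) c) * AdjoinRoot.root _ ^ k := by
      rw [← h, ofPoly, RingHom.comp_apply, coe_mapRingHom, map_monomial]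
    refine ⟨monomial k c, AdjoinRoot.of _ y * AdjoinRoot.root _ ^ k,
      AdjoinRoot.of _ z * AdjoinRoot.root _ ^ k, ?_⟩
    rw [h, h', uElt, vElt]
    simp only [map_add, map_mul]
    ring

theorem polyRep_uv_coeff {G : F[X]} (hG : G.natDegree < n) :
    polyRep n a (fun i => algebraMap F (UVRing F) (G.coeff i) * (UVRing.u F * UVRing.v F)) =
      uElt n a * vElt n a * ofPoly n a G := by
  have h : (fun i : Fin n => algebraMap F (UVRing F) (G.coeff i) * (UVRing.u F * UVRing.v F)) =
      fun i : Fin n => UVRing.u F * UVRing.v F * (G.map (algebraMap F (UVRing F))).coeff i := by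
    funext i
    rw [coeff_map, mul_comm]
  rw [h, polyRep_mul (UVRing.u F * UVRing.v F)
    (fun i : Fin n => (G.map (algebraMap F (UVRing F))).coeff i),
    polyRep_coeff (natDegree_map_le.trans_lt hG), map_mul]
  rfl

open Classical in
theorem hammingNorm_uv_coeff {G : F[X]} (hG : G.natDegree < n) :
    hammingNorm (fun i : Fin n =>
      algebraMap F (UVRing F) (G.coeff i) * (UVRing.u F * UVRing.v F)) = G.support.card := by
  rw [hammingNorm]
  refine Finset.card_bij (fun i _ => (i : ℕ)) ?_ ?_ ?_
  · intro i hi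
    rw [Finset.mem_filter] at hi
    rw [mem_support_iff]
    exact fun h => hi.2 (UVRing.algebraMap_mul_u_mul_v_eq_zero.2 h)
  · exact fun _ _ _ _ h => Fin.ext h
  · intro i hi
    refine ⟨⟨i, (le_natDegree_of_mem_supp i hi).trans_lt hG⟩, ?_, rfl⟩
    rw [Finset.mem_filter]
    exact ⟨Finset.mem_univ _, fun h => mem_support_iff.1 hi
      (UVRing.algebraMap_mul_u_mul_v_eq_zero.1 h)⟩

theorem exists_eq_uElt_mul {x : Fin n → UVRing F} (h : (fun i => UVRing.u F * x i) = 0) :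
    ∃ c, polyRep n a x = uElt n a * c := by
  choose y hy using fun i => UVRing.exists_eq_u_mul_of_u_mul_eq_zero (congrFun h i)
  exact ⟨polyRep n a y, by rw [funext hy, polyRep_mul]; rfl⟩

end Ambient

/-! ### The constacyclic ring when `b` (that is, `α₀`) is not a square -/

section Nonsquare

variable {F : Type*} [Field F] {p s : ℕ} [Fact p.Prime] [CharP F p] {α₁ α₃ α₄ b : F}

local notation "𝓡" => ConstacyclicRing (2 * p ^ s) (alphaElt α₁ α₃ α₄)
local notation "𝓤" => uElt (2 * p ^ s) (alphaElt α₁ α₃ α₄)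
local notation "𝓥" => vElt (2 * p ^ s) (alphaElt α₁ α₃ α₄)
local notation "𝓦" => quadElt (2 * p ^ s) (alphaElt α₁ α₃ α₄) b
local notation "𝓕" => ofPoly (2 * p ^ s) (alphaElt α₁ α₃ α₄)

theorem quadElt_pow_char_pow (hb : b ^ p ^ s = α₁) :
    𝓦 ^ p ^ s = 𝓥 * (𝓕 (C α₃) + 𝓕 (C α₄) * 𝓤) := by
  have h : AdjoinRoot.mk (X ^ (2 * p ^ s) - C (alphaElt α₁ α₃ α₄)) (X ^ (2 * p ^ s)) =
      AdjoinRoot.of _ (alphaElt α₁ α₃ α₄) := by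
    rw [← AdjoinRoot.mk_C, ← sub_eq_zero, ← map_sub, AdjoinRoot.mk_self]
  rw [quadElt_eq_ofPoly, ← map_pow, sub_pow_char_pow, ← pow_mul, ← C_pow, hb, map_sub, ofPoly_C,
    ofPoly_C, ofPoly_C, ofPoly, RingHom.comp_apply, coe_mapRingHom, Polynomial.map_pow, map_X, h,
    alphaElt, uElt, vElt]
  simp only [map_add, map_mul]
  ring

theorem uElt_mul_quadElt_pow_char_pow (hb : b ^ p ^ s = α₁) :
    𝓤 * 𝓦 ^ p ^ s = 𝓤 * 𝓥 * 𝓕 (C α₃) := by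
  rw [quadElt_pow_char_pow hb]
  linear_combination 𝓥 * 𝓕 (C α₄) * uElt_mul_self (a := alphaElt α₁ α₃ α₄) (n := 2 * p ^ s)

theorem vElt_mul_quadElt_pow_char_pow (hb : b ^ p ^ s = α₁) : 𝓥 * 𝓦 ^ p ^ s = 0 := by
  rw [quadElt_pow_char_pow hb, ← mul_assoc, vElt_mul_self, zero_mul]

theorem quadElt_dvd_vElt (hb : b ^ p ^ s = α₁) (hα₃ : α₃ ≠ 0) : 𝓦 ∣ 𝓥 := by
  have h1 := quadElt_pow_char_pow (α₃ := α₃) (α₄ := α₄) hb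
  have h2 := ofPoly_C_mul_inv (n := 2 * p ^ s) (a := alphaElt α₁ α₃ α₄) hα₃
  -- The last factor inverts `α₃ + α₄ u`, since `u² = 0`.
  have h3 : 𝓥 = 𝓦 ^ p ^ s * (𝓕 (C α₃⁻¹) ^ 2 * (𝓕 (C α₃) - 𝓕 (C α₄) * 𝓤)) := by
    rw [h1]
    linear_combination -𝓥 * (1 + 𝓕 (C α₃) * 𝓕 (C α₃⁻¹)) * h2 +
      𝓥 * 𝓕 (C α₃⁻¹) ^ 2 * 𝓕 (C α₄) ^ 2 *
        uElt_mul_self (a := alphaElt α₁ α₃ α₄) (n := 2 * p ^ s)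
  rw [h3]
  exact (dvd_pow_self _ (pow_pos (Fact.out : p.Prime).pos s).ne').mul_right _

/-- Modulo the nilpotents `u` and `W`, hence modulo `v`, only the field `F[X] / ⟨X² - b⟩` remains. A
Bézout inverse there lifts. -/
theorem isUnit_or_exists_eq (hb : b ^ p ^ s = α₁) (hα₃ : α₃ ≠ 0) (hsq : ¬ IsSquare b) (x : 𝓡) :
    IsUnit x ∨ ∃ y z, x = 𝓤 * y + 𝓦 * z := by
  obtain ⟨d, hd⟩ := quadElt_dvd_vElt (α₄ := α₄) hb hα₃
  obtain ⟨Q, y, z, rfl⟩ := exists_eq_ofPoly_add x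
  have hirr : Irreducible (X ^ 2 - C b) :=
    (X_pow_sub_C_irreducible_iff_of_prime Nat.prime_two).2 fun c hc =>
      hsq ⟨c, by rw [← hc, pow_two]⟩
  by_cases hQ : X ^ 2 - C b ∣ Q
  swap
  · left
    obtain ⟨A, B, hAB⟩ := hirr.coprime_iff_not_dvd.2 hQ
    have h1 : 𝓕 A * 𝓦 + 𝓕 B * 𝓕 Q = 1 := by
      rw [quadElt_eq_ofPoly, ← map_mul, ← map_mul, ← map_add, hAB, map_one]
    have hW : IsNilpotent 𝓦 := by
      refine ⟨p ^ s + p ^ s, ?_⟩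
      rw [pow_add]
      nth_rewrite 1 [quadElt_pow_char_pow hb]
      linear_combination (𝓕 (C α₃) + 𝓕 (C α₄) * 𝓤) *
        vElt_mul_quadElt_pow_char_pow (α₃ := α₃) (α₄ := α₄) hb
    have hU : IsNilpotent 𝓤 := ⟨2, (pow_two _).trans uElt_mul_self⟩
    have hnil : IsNilpotent (𝓤 * (𝓕 B * y) + 𝓦 * (𝓕 B * d * z - 𝓕 A)) :=
      Commute.isNilpotent_add (Commute.all _ _) (Commute.isNilpotent_mul_right (Commute.all _ _) hU)
        (Commute.isNilpotent_mul_right (Commute.all _ _) hW)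
    refine isUnit_of_mul_isUnit_right (x := 𝓕 B) ?_
    convert hnil.isUnit_one_add using 1
    rw [hd]
    linear_combination h1
  · right
    obtain ⟨Q', rfl⟩ := hQ
    refine ⟨y, 𝓕 Q' + d * z, ?_⟩
    rw [map_mul, ← quadElt_eq_ofPoly, hd]
    ring

/-- The chain property of the multiples of `u`: an ideal that contains no `u (x² - b) ^ j` with
`j < e` contains no multiple of `u` outside `⟨u (x² - b) ^ e⟩`. -/
theorem exists_eq_uElt_mul_quadElt_pow_mul (hb : b ^ p ^ s = α₁) (hα₃ : α₃ ≠ 0)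
    (hsq : ¬ IsSquare b) {K : Ideal 𝓡} {c : 𝓡} (hc : 𝓤 * c ∈ K) (e : ℕ)
    (he : ∀ j < e, 𝓤 * 𝓦 ^ j ∉ K) : ∃ d, 𝓤 * c = 𝓤 * 𝓦 ^ e * d := by
  induction e with
  | zero => exact ⟨c, by simp⟩
  | succ e ih =>
    obtain ⟨d, hd⟩ := ih fun j hj => he j (hj.trans e.lt_succ_self)
    -- A unit `d` would put `u W ^ e` in `K`; otherwise `u² = 0` removes the `u`-part of `d` and one
    -- more `W` splits off.
    rcases isUnit_or_exists_eq hb hα₃ hsq d with ⟨d, rfl⟩ | ⟨y, z, rfl⟩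
    · exact absurd ((Ideal.mul_unit_mem_iff_mem K d.isUnit).1 (hd ▸ hc)) (he e e.lt_succ_self)
    · refine ⟨z, ?_⟩
      rw [hd]
      linear_combination 𝓦 ^ e * y * uElt_mul_self (a := alphaElt α₁ α₃ α₄) (n := 2 * p ^ s)

theorem idealDist_eq_idealDist_typeB (hb : b ^ p ^ s = α₁) (hα₃ : α₃ ≠ 0) (hsq : ¬ IsSquare b)
    {l t e : ℕ} {z : 𝓡}
    (he : IsLeast {k | 𝓤 * 𝓦 ^ k ∈ typeC (2 * p ^ s) (alphaElt α₁ α₃ α₄) b l t z} e) (hel : e ≤ l) :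
    idealDist (typeC (2 * p ^ s) (alphaElt α₁ α₃ α₄) b l t z) =
      idealDist (typeB (2 * p ^ s) (alphaElt α₁ α₃ α₄) b e) := by
  classical
  refine idealDist_eq_of_le ((Ideal.span_singleton_le_iff_mem _).2 he.1) fun x hx hxK => ?_
  by_cases hux : (fun i => UVRing.u F * x i) = 0
  · refine ⟨x, hx, ?_, le_rfl⟩
    obtain ⟨c, hc⟩ := exists_eq_uElt_mul (a := alphaElt α₁ α₃ α₄) hux
    rw [hc] at hxK ⊢
    obtain ⟨d, hd⟩ := exists_eq_uElt_mul_quadElt_pow_mul hb hα₃ hsq hxK e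
      fun j hj hmem => (he.2 hmem).not_gt hj
    rw [hd]
    exact Ideal.mul_mem_right _ _ (Ideal.mem_span_singleton_self _)
  -- The word `u x` works: `u` times the generator is `u W ^ l`, and `e ≤ l`.
  · refine ⟨_, hux, ?_, ?_⟩
    · rw [polyRep_mul]
      obtain ⟨d, hd⟩ := Ideal.mem_span_singleton'.1 hxK
      rw [← hd, typeB, Ideal.mem_span_singleton]
      refine ⟨𝓦 ^ (l - e) * d, ?_⟩
      have hpow : 𝓦 ^ l = 𝓦 ^ e * 𝓦 ^ (l - e) := by rw [← pow_add, Nat.add_sub_cancel' hel]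
      rw [← uElt, hpow]
      linear_combination d * 𝓦 ^ t * z * uElt_mul_self (a := alphaElt α₁ α₃ α₄) (n := 2 * p ^ s)
    · refine Finset.card_le_card fun i hi => ?_
      rw [Finset.mem_filter] at hi ⊢
      exact ⟨hi.1, fun h => hi.2 (by simp only [h, mul_zero])⟩

theorem idealDist_typeB_of_le (hb : b ^ p ^ s = α₁) (hα₃ : α₃ ≠ 0) {e : ℕ} (he : e ≤ p ^ s) :
    idealDist (typeB (2 * p ^ s) (alphaElt α₁ α₃ α₄) b e) = 1 := by
  classical
  have hn : 0 < 2 * p ^ s := Nat.mul_pos two_pos (pow_pos (Fact.out : p.Prime).pos s)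
  have hdeg : (C α₃).natDegree < 2 * p ^ s := by rwa [natDegree_C]
  have hnorm := hammingNorm_uv_coeff hdeg
  have hcard : (C α₃).support.card = 1 := by rw [support_C hα₃, Finset.card_singleton]
  refine idealDist_eq_of_forall ⟨_, ?_, ?_, (hnorm.trans hcard).le⟩
    fun x hx _ => hammingNorm_pos_iff.2 hx
  · rw [← hammingNorm_ne_zero_iff, hnorm, hcard]
    exact one_ne_zero
  · rw [polyRep_uv_coeff hdeg, ← uElt_mul_quadElt_pow_char_pow hb, typeB, Ideal.mem_span_singleton]
    exact mul_dvd_mul_left _ (pow_dvd_pow _ he)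

theorem mem_typeB_iff (hb : b ^ p ^ s = α₁) (hα₃ : α₃ ≠ 0) {i : ℕ} (x : 𝓡) :
    x ∈ typeB (2 * p ^ s) (alphaElt α₁ α₃ α₄) b (p ^ s + i) ↔
      ∃ Q : F[X], x = 𝓤 * 𝓥 * 𝓕 ((X ^ 2 - C b) ^ i * Q) := by
  have hgen : 𝓤 * 𝓦 ^ (p ^ s + i) = 𝓤 * 𝓥 * 𝓕 (C α₃) * 𝓦 ^ i := by
    rw [pow_add, ← mul_assoc, uElt_mul_quadElt_pow_char_pow hb]
  rw [typeB, Ideal.mem_span_singleton, hgen]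
  constructor
  · rintro ⟨y, rfl⟩
    obtain ⟨Q, y, z, rfl⟩ := exists_eq_ofPoly_add y
    refine ⟨C α₃ * Q, ?_⟩
    rw [map_mul, map_mul, map_pow, ← quadElt_eq_ofPoly]
    linear_combination
      𝓥 * 𝓕 (C α₃) * 𝓦 ^ i * y * uElt_mul_self (a := alphaElt α₁ α₃ α₄) (n := 2 * p ^ s) +
      𝓤 * 𝓕 (C α₃) * 𝓦 ^ i * z * vElt_mul_self (a := alphaElt α₁ α₃ α₄) (n := 2 * p ^ s)
  · rintro ⟨Q, rfl⟩
    refine ⟨𝓕 (C α₃⁻¹) * 𝓕 Q, ?_⟩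
    rw [map_mul, map_pow, ← quadElt_eq_ofPoly]
    linear_combination -𝓤 * 𝓥 * 𝓦 ^ i * 𝓕 Q *
      ofPoly_C_mul_inv (n := 2 * p ^ s) (a := alphaElt α₁ α₃ α₄) hα₃

/-- Reduction modulo `(X² - b) ^ p ^ s` changes nothing after multiplication by `v`, and it
preserves divisibility by `(X² - b) ^ i` because `i ≤ p ^ s`. -/
theorem exists_eq_uv_coeff (hb : b ^ p ^ s = α₁) (hα₃ : α₃ ≠ 0) {i : ℕ} (hi : i ≤ p ^ s)
    {x : Fin (2 * p ^ s) → UVRing F}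
    (hx : polyRep (2 * p ^ s) (alphaElt α₁ α₃ α₄) x ∈
      typeB (2 * p ^ s) (alphaElt α₁ α₃ α₄) b (p ^ s + i)) :
    ∃ G : F[X], G.natDegree < 2 * p ^ s ∧ (X ^ 2 - C b) ^ i ∣ G ∧
      x = fun j : Fin (2 * p ^ s) =>
        algebraMap F (UVRing F) (G.coeff j) * (UVRing.u F * UVRing.v F) := by
  have hpos := pow_pos (Fact.out : p.Prime).pos s
  have hn : 0 < 2 * p ^ s := Nat.mul_pos two_pos hpos
  obtain ⟨Q, hQ⟩ := (mem_typeB_iff hb hα₃ _).1 hx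
  set M : F[X] := (X ^ 2 - C b) ^ p ^ s with hM
  have hmonic : M.Monic := (monic_X_pow_sub_C b two_ne_zero).pow _
  have hMdeg : M.natDegree = 2 * p ^ s := by
    rw [hM, natDegree_pow, natDegree_X_pow_sub_C, mul_comm]
  have hM1 : M ≠ 1 := by
    intro h
    rw [h, natDegree_one] at hMdeg
    omega
  have hdiv := modByMonic_add_div ((X ^ 2 - C b) ^ i * Q) M
  have hdeg := natDegree_modByMonic_lt ((X ^ 2 - C b) ^ i * Q) hmonic hM1
  rw [hMdeg] at hdeg
  set G := ((X ^ 2 - C b) ^ i * Q) %ₘ M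
  refine ⟨G, hdeg, ?_, ?_⟩
  · have hd : (X ^ 2 - C b) ^ i ∣ M * (((X ^ 2 - C b) ^ i * Q) /ₘ M) :=
      (pow_dvd_pow _ hi).mul_right _
    refine (dvd_add_left hd).1 ?_
    rw [hdiv]
    exact dvd_mul_right _ _
  · rw [← sub_eq_zero, ← polyRep_eq_zero (a := alphaElt α₁ α₃ α₄) hn, polyRep_sub, hQ,
      polyRep_uv_coeff hdeg, ← hdiv, map_add, map_mul, hM, map_pow, ← quadElt_eq_ofPoly]
    linear_combination 𝓤 * 𝓕 (((X ^ 2 - C b) ^ i * Q) /ₘ (X ^ 2 - C b) ^ p ^ s) *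
      vElt_mul_quadElt_pow_char_pow (α₃ := α₃) (α₄ := α₄) hb

theorem idealDist_typeB_add (hb : b ^ p ^ s = α₁) (hb0 : b ≠ 0) (hα₃ : α₃ ≠ 0) {k γ G i : ℕ}
    (hs : s = γ + k + 1) (hG : G + 1 < p)
    (h1 : (p ^ γ - 1) * p ^ (k + 1) + G * p ^ k + 1 ≤ i)
    (h2 : i ≤ (p ^ γ - 1) * p ^ (k + 1) + (G + 1) * p ^ k) :
    idealDist (typeB (2 * p ^ s) (alphaElt α₁ α₃ α₄) b (p ^ s + i)) = (G + 2) * p ^ γ := by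
  classical
  have hp := (Fact.out : p.Prime).pos
  have hlt : (p ^ γ - 1) * p ^ (k + 1) + (G + 1) * p ^ k < p ^ s := by
    have h3 : p ^ s = (p ^ γ - 1) * p ^ (k + 1) + p ^ (k + 1) := by
      rw [← Nat.succ_mul, Nat.succ_eq_add_one, Nat.sub_add_cancel (pow_pos hp γ), ← pow_add, hs,
        add_assoc]
    rw [h3, pow_succ' p k]
    exact Nat.add_lt_add_left (Nat.mul_lt_mul_of_pos_right hG (pow_pos hp k)) _
  apply idealDist_eq_of_forall
  -- The right end of the range gives the sparse codeword `uv (X² - b) ^ N`.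
  · set N := (p ^ γ - 1) * p ^ (k + 1) + (G + 1) * p ^ k with hN
    have hdeg : ((X ^ 2 - C b) ^ N : F[X]).natDegree < 2 * p ^ s := by
      rw [natDegree_pow, natDegree_X_pow_sub_C]
      omega
    have hnorm := hammingNorm_uv_coeff hdeg
    refine ⟨_, ?_, ?_, hnorm.le.trans (card_support_X_sq_sub_C_pow_le b k (G + 1) γ)⟩
    · rw [← hammingNorm_ne_zero_iff, hnorm, Finset.card_ne_zero, support_nonempty]
      exact pow_ne_zero _ (X_pow_sub_C_ne_zero two_pos b)
    · rw [polyRep_uv_coeff hdeg, mem_typeB_iff hb hα₃]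
      exact ⟨(X ^ 2 - C b) ^ (N - i), by rw [← pow_add, Nat.add_sub_cancel' h2]⟩
  · intro x hx hxB
    obtain ⟨g, hdeg, hdvd, rfl⟩ := exists_eq_uv_coeff hb hα₃ (h2.trans hlt.le) hxB
    have hg : g ≠ 0 := by
      rintro rfl
      exact hx (by funext; simp)
    rw [hammingNorm_uv_coeff hdeg]
    subst hs
    exact le_card_support_of_X_sq_sub_C_pow_dvd hb0 hg hdeg ((pow_dvd_pow _ h1).trans hdvd)

end Nonsquare

/-! ### The root `α₀` and the assembly of the theorem -/

theorem alphaZero_pow {F : Type*} [Field F] [Finite F] {p m s : ℕ} (hm : 0 < m)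
    (hF : Nat.card F = p ^ m) (α : F) : alphaZero p m s α ^ p ^ s = α := by
  have hs : s ≤ (s / m + 1) * m := by
    rw [mul_comm]
    exact (Nat.lt_mul_div_succ s hm).le
  have := Fintype.ofFinite F
  rw [alphaZero, ← pow_mul, ← pow_add, Nat.sub_add_cancel hs, mul_comm, pow_mul, ← hF,
    Nat.card_eq_fintype_card, FiniteField.pow_card_pow]

/-- The first conjunct of the conclusion says that the exponent `leastExp` exists, so that it is
never the default value of an infimum over the empty set. -/
theorem theorem8 (p m s : ℕ) (hp : p.Prime) (hp2 : p ≠ 2) (hm : 0 < m) (hs : 0 < s)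
    (F : Type*) [Field F] [Finite F] (hF : Nat.card F = p ^ m)
    (α₁ α₃ α₄ : F) (hα₁ : α₁ ≠ 0) (hα₃ : α₃ ≠ 0)
    (hα : ¬ IsSquare (alphaElt α₁ α₃ α₄))
    (l t : ℕ) (hl : l ≤ 2 * p ^ s - 1) (ht : t < l)
    (z : ConstacyclicRing (2 * p ^ s) (alphaElt α₁ α₃ α₄)) (hz : z = 0 ∨ IsUnit z)
    (K : Ideal (ConstacyclicRing (2 * p ^ s) (alphaElt α₁ α₃ α₄)))
    (hK : K = typeC (2 * p ^ s) (alphaElt α₁ α₃ α₄) (alphaZero p m s α₁) l t z)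
    (e : ℕ) (he : e = leastExp (alphaZero p m s α₁) K) :
    IsLeast {k : ℕ | uElt (2 * p ^ s) (alphaElt α₁ α₃ α₄) *
        quadElt (2 * p ^ s) (alphaElt α₁ α₃ α₄) (alphaZero p m s α₁) ^ k ∈ K} e ∧
    idealDist K =
      idealDist (typeB (2 * p ^ s) (alphaElt α₁ α₃ α₄) (alphaZero p m s α₁) e) ∧
    (e ≤ p ^ s → idealDist K = 1) ∧
    (∀ Γ γ : ℕ, 1 ≤ Γ → Γ ≤ p - 1 → γ ≤ s - 1 →
      2 * p ^ s - p ^ (s - γ) + (Γ - 1) * p ^ (s - γ - 1) + 1 ≤ e →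
      e ≤ 2 * p ^ s - p ^ (s - γ) + Γ * p ^ (s - γ - 1) →
      idealDist K = (Γ + 1) * p ^ γ) := by

  have := Fintype.ofFinite F
  have hFact : Fact p.Prime := ⟨hp⟩
  have hchar : CharP F p := charP_of_card_eq_prime_pow (by rw [← Nat.card_eq_fintype_card, hF])
  have hb : alphaZero p m s α₁ ^ p ^ s = α₁ := alphaZero_pow hm hF α₁
  have hb0 : alphaZero p m s α₁ ≠ 0 := pow_ne_zero _ hα₁
  have h2 : (2 : F) ≠ 0 := by
    intro h
    have h' : ((2 : ℕ) : F) = 0 := by exact_mod_cast h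
    rw [CharP.cast_eq_zero_iff F p] at h'
    exact hp2 ((Nat.prime_dvd_prime_iff_eq hp Nat.prime_two).1 h')
  have hsq : ¬ IsSquare (alphaZero p m s α₁) := fun h =>
    hα (isSquare_alphaElt h2 hα₁ (hb ▸ h.pow _) α₃ α₄)
  have hmem : uElt (2 * p ^ s) (alphaElt α₁ α₃ α₄) *
      quadElt (2 * p ^ s) (alphaElt α₁ α₃ α₄) (alphaZero p m s α₁) ^ l ∈ K := by
    rw [hK, typeC, Ideal.mem_span_singleton]
    refine ⟨uElt (2 * p ^ s) (alphaElt α₁ α₃ α₄), ?_⟩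
    linear_combination
      -quadElt (2 * p ^ s) (alphaElt α₁ α₃ α₄) (alphaZero p m s α₁) ^ t * z *
        uElt_mul_self (a := alphaElt α₁ α₃ α₄) (n := 2 * p ^ s)
  have hleast : IsLeast {k : ℕ | uElt (2 * p ^ s) (alphaElt α₁ α₃ α₄) *
      quadElt (2 * p ^ s) (alphaElt α₁ α₃ α₄) (alphaZero p m s α₁) ^ k ∈ K} e :=
    he ▸ ⟨Nat.sInf_mem ⟨l, hmem⟩, fun k hk => Nat.sInf_le hk⟩
  have hdist : idealDist K =
      idealDist (typeB (2 * p ^ s) (alphaElt α₁ α₃ α₄) (alphaZero p m s α₁) e) := by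
    have hel : e ≤ l := hleast.2 hmem
    rw [hK] at hleast ⊢
    exact idealDist_eq_idealDist_typeB hb hα₃ hsq hleast hel
  refine ⟨hleast, hdist, fun hle => hdist.trans (idealDist_typeB_of_le hb hα₃ hle), ?_⟩
  intro Γ γ hΓ hΓp hγ h1 h2
  rw [hdist]
  -- With `Γ = G + 1`, `k = s - γ - 1` and `e = p ^ s + i`, the bounds on `e` become bounds on `i`,
  -- as `p ^ s - p ^ (s - γ) = (p ^ γ - 1) p ^ (k + 1)`.
  obtain ⟨G, rfl⟩ := Nat.exists_eq_add_of_le' hΓ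
  obtain ⟨k, rfl⟩ : ∃ k, s = γ + k + 1 := ⟨s - γ - 1, by omega⟩
  have hpos := pow_pos hp.pos γ
  have hps : p ^ (γ + k + 1) = (p ^ γ - 1) * p ^ (k + 1) + p ^ (k + 1) := by
    rw [← Nat.succ_mul, Nat.succ_eq_add_one, Nat.sub_add_cancel hpos, ← pow_add, add_assoc]
  rw [show γ + k + 1 - γ = k + 1 by omega, Nat.add_sub_cancel, Nat.add_sub_cancel] at h1
  rw [show γ + k + 1 - γ = k + 1 by omega, Nat.add_sub_cancel] at h2
  obtain ⟨i, rfl⟩ : ∃ i, e = p ^ (γ + k + 1) + i := ⟨e - p ^ (γ + k + 1), by omega⟩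
  exact idealDist_typeB_add hb hb0 hα₃ rfl (by omega) (by omega) (by omega)
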